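/- An *incomplete binary tree* is a finite rooted tree in which each vertex has a possibly empty left subtree and a possibly empty right subtree. Once the root has been given a label, the other vertices are labelled so that a left child has the label of its parent minus one and a right child the label of its parent plus one. Edges are oriented away from the root, and $|t|$ denotes the number of edges of $t$. Fix $V\ge 1$, and let $T$ be uniformly distributed on the incomplete binary trees with $V$ edges, with root label $0$; write $\Pi_0^{(V)}$ for its law. For $m\ge 1$ let $X_m^+$ (resp. $X_m^-$) be the number of oriented edges of $T$ from label $m-1$ to label $m$ (resp. from label $m$ to label $m-1$), and let $M_m^-$ be the number of edges whose two endpoints both have label at most $m-1$. Put $\bar{\mathcal X}_m=(X_m^+,X_m^-,M_m^-)$ and $$\mathfrak S^{(V)}=(\mathbb N_{>0}\times\mathbb N_{\ge 0}\times\{0,1,\dots,V\})\cup\{(0,0,V)\}.$$ Let $\Pi^+$ be the law of the following random tree $\tau$: start from one root vertex with label $1$, let each vertex have a left child with probability $1/2$ and, independently, a right child with probability $1/2$, and finally delete all strict descendants of vertices with label $0$. Let $n_\tau$ be the number of vertices of $\tau$ with label $0$. For integers $p,q\ge 0$ and $l\in\mathbb Z$ let $$\tilde f_p(q,l)=\mathbb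 P\Big(\sum_{k=1}^p n_{\tau_k}=q,\ \sum_{k=1}^p|\tau_k|=l\Big),$$ where $\tau_1,\dots,\tau_p$ are i.i.d. with law $\Pi^+$ (so $\tilde f_p(q,l)=0$ if $l<0$, and $\tilde f_0(q,l)=\mathbf 1_{\{q=l=0\}}$). **Theorem.** Under $\Pi_0^{(V)}$ the process $(\bar{\mathcal X}_m)_{m\ge 1}$ is a time-homogeneous Markov chain with the following transition kernel. Let $(p,q,v),(r,s,w)\in\mathfrak S^{(V)}$ and let $m\ge 1$ be such that $\Pi_0^{(V)}(\bar{\mathcal X}_m=(p,q,v))>0$. Then $\tilde f_p(q,V-v-p)>0$ and $$\Pi_0^{(V)}\big(\bar{\mathcal X}_{m+1}=(r,s,w)\,\big|\,\bar{\mathcal X}_m=(p,q,v)\big)=\begin{cases}\dfrac{p\,4^{-p-s}}{p+s}\dbinom{p+s}{r}\dbinom{p+s}{q}\dfrac{\tilde f_r(s,V-w-r)}{\tilde f_p(q,V-v-p)}&\text{if } w=v+p+q,\\[2mm]0&\text{otherwise,}\end{cases}$$ where the first line is read as $1$ if $p=q=r=s=0$, and as $0$ if $p=s=0$ and $r\geq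 1$. Moreover, the same value is obtained if one conditions on $\{\bar{\mathcal X}_k=x_k \text{ for all } 1\le k\le m\}$ instead, for any $x_1,\dots,x_m$ with $x_m=(p,q,v)$ such that this event has positive probability. -/

import Mathlib

open MeasureTheory ProbabilityTheory
open scoped ENNReal

noncomputable section

namespace EdgeProfile

/-- Incomplete binary trees: a vertex is a `node` and `nil` stands for an absent subtree, so that a
tree (which has at least its root vertex) is a term different from `nil`. -/
abbrev BTree : Type := BinaryTree Unit

instance : MeasurableSpace BTree := ⊤

/-- The number `|t|` of edges of a nonempty tree `t`. -/
def numEdges (t : BTree) : ℕ := t.numNodes - 1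

/-- The multiset of vertex labels of the tree whose root has label `x`: a left child has the label
of its parent minus one, a right child the label of its parent plus one. -/
def labels : ℤ → BTree → Multiset ℤ
  | _, .nil => 0
  | x, .node _ l r => x ::ₘ (labels (x - 1) l + labels (x + 1) r)

/-- The edge from a parent labelled `x` to the root, labelled `y`, of a possibly absent subtree. -/
def edgeTo (x y : ℤ) : BTree → Multiset (ℤ × ℤ)
  | .nil => 0
  | .node _ _ _ => {(x, y)}

/-- The multiset of the pairs (label of parent, label of child) over all edges of the tree whose
root has label `x`. -/
def edges : ℤ → BTree → Multiset (ℤ × ℤ)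
  | _, .nil => 0
  | x, .node _ l r =>
      edgeTo x (x - 1) l + edgeTo x (x + 1) r + (edges (x - 1) l + edges (x + 1) r)

/-- `X_m^+`: number of edges from label `m - 1` to label `m`, the root being labelled `0`. -/
def upCount (m : ℕ) (t : BTree) : ℕ := (edges 0 t).count ((m : ℤ) - 1, (m : ℤ))

/-- `X_m^-`: number of edges from label `m` to label `m - 1`, the root being labelled `0`. -/
def downCount (m : ℕ) (t : BTree) : ℕ := (edges 0 t).count ((m : ℤ), (m : ℤ) - 1)

/-- `M_m^-`: number of edges with both labels at most `m - 1`, the root being labelled `0`. -/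
def massBelow (m : ℕ) (t : BTree) : ℕ :=
  (edges 0 t).countP fun e => e.1 ≤ (m : ℤ) - 1 ∧ e.2 ≤ (m : ℤ) - 1

/-- The triple `(X_m^+, X_m^-, M_m^-)`. -/
def profile (m : ℕ) (t : BTree) : ℕ × ℕ × ℕ := (upCount m t, downCount m t, massBelow m t)

/-- The state space of the process `(X_m^+, X_m^-, M_m^-)` for trees with `V` edges. -/
def stateSpace (V : ℕ) : Set (ℕ × ℕ × ℕ) :=
  {x | 0 < x.1 ∧ x.2.2 ≤ V} ∪ {(0, 0, V)}

/-- The uniform distribution on incomplete binary trees with `V` edges. -/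
def uniformTree (V : ℕ) : Measure BTree :=
  uniformOn {t : BTree | t ≠ .nil ∧ numEdges t = V}

/-- The law of the random binary tree in which each vertex has a left child with probability `1/2`
and, independently, a right child with probability `1/2`: every vertex of a tree contributes a
factor `1/4`, so a nonempty tree `t` has probability `4 ^ (-|t| - 1)`. -/
def treeLaw : Measure BTree :=
  Measure.sum fun t : {t : BTree // t ≠ .nil} =>
    ((4 : ℝ≥0∞)⁻¹ ^ (numEdges t.1 + 1)) • Measure.dirac t.1

/-- Truncation at level `0` of the tree whose root has label `x`: all strict descendants of the
vertices with label `0` are deleted. -/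
def truncate : ℤ → BTree → BTree
  | _, .nil => .nil
  | x, .node a l r =>
      if x = 0 then .node a .nil .nil
      else .node a (truncate (x - 1) l) (truncate (x + 1) r)

/-- `Π^+`: the law of the truncation at level `0` of the random binary tree with root label `1`. -/
def excursionLaw : Measure BTree := treeLaw.map (truncate 1)

/-- `n_τ`: the number of vertices with label `0` in the tree `τ` with root label `1`. -/
def zeroCount (τ : BTree) : ℕ := (labels 1 τ).count 0

/-- The probability that `p` independent excursions `τ₁, …, τ_p` with law `Π^+` satisfy
`n_{τ₁} + ⋯ + n_{τ_p} = q` and `|τ₁| + ⋯ + |τ_p| = l`. -/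
def jointLaw (p q : ℕ) (l : ℤ) : ℝ :=
  (Measure.pi fun _ : Fin p => excursionLaw).real
    {τ | ∑ k, zeroCount (τ k) = q ∧ ((∑ k, numEdges (τ k) : ℕ) : ℤ) = l}

end EdgeProfile

end

/-!
Cut a tree at its vertices labelled `m`. The subtree at such a vertex consists of an optional part
below `m`, an optional part above `m`, and further subtrees attached to the vertices labelled `m` of
these parts. By the Otter–Dwass formula, the forests of `k` such subtrees with `N` vertices labelled
`m` in total correspond, with weight `k / N`, to `N`-tuples of pairs of optional parts. If `q` of
the lower and `r` of the upper parts are present and `s` edges lead from `m + 1` to `m`, then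
`N = p + s`, and the tuples are counted by `C(N, q) C(N, r)` times a factor for the `q` lower parts
times the number of `r`-tuples of excursions above `m`. The whole past of the profile up to time `m`
is read off from the parts below `m`, so it enters through the lower factor only, which cancels in
the conditional probability. Applied to a forest of `p` excursions, the same formula sums the
remaining factor over `(r, s)`. Finally, an excursion `τ` has probability
`4 ^ (n_τ - |τ| - 1)`, since the trees attached at a vertex labelled `0` have total weight `4`
relative to that of a single vertex. The powers of `4` combine to `4 ^ (-p - s)`.
-/

noncomputable section

namespace EdgeProfile

section TupleSum

variable {A ι κ : Type*} [AddCommMonoid A]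

/-- The sum of `φ (e i₁ + ⋯ + e iₖ)` over all `k`-tuples of indices. Choosing for `φ` the indicator
of a set counts the `k`-tuples whose total lies in that set. -/
def tupleSum (e : ι → A) (k : ℕ) (φ : A → ℝ≥0∞) : ℝ≥0∞ :=
  ∑' i : Fin k → ι, φ (∑ j, e (i j))

lemma tupleSum_zero (e : ι → A) (φ : A → ℝ≥0∞) : tupleSum e 0 φ = φ 0 := by
  simp [tupleSum, tsum_fintype]

lemma tupleSum_succ (e : ι → A) (k : ℕ) (φ : A → ℝ≥0∞) :
    tupleSum e (k + 1) φ = ∑' i, tupleSum e k fun a => φ (e i + a) := by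
  rw [tupleSum, ← (Fin.consEquiv fun _ => ι).tsum_eq, ENNReal.tsum_prod']
  simp only [tupleSum, Fin.consEquiv, Equiv.coe_fn_mk, Fin.sum_univ_succ, Fin.cons_zero,
    Fin.cons_succ]

lemma tupleSum_one (e : ι → A) (φ : A → ℝ≥0∞) : tupleSum e 1 φ = ∑' i, φ (e i) := by
  simp [tupleSum_succ, tupleSum_zero]

lemma tupleSum_fun_add (e : ι → A) (k : ℕ) (φ ψ : A → ℝ≥0∞) :
    tupleSum e k (fun a => φ a + ψ a) = tupleSum e k φ + tupleSum e k ψ :=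
  ENNReal.tsum_add

lemma tupleSum_const_mul (e : ι → A) (k : ℕ) (c : ℝ≥0∞) (φ : A → ℝ≥0∞) :
    tupleSum e k (fun a => c * φ a) = c * tupleSum e k φ :=
  ENNReal.tsum_mul_left

lemma tupleSum_mul_const (e : ι → A) (k : ℕ) (c : ℝ≥0∞) (φ : A → ℝ≥0∞) :
    tupleSum e k (fun a => φ a * c) = tupleSum e k φ * c :=
  ENNReal.tsum_mul_right

lemma tupleSum_fun_tsum (e : ι → A) (k : ℕ) (φ : κ → A → ℝ≥0∞) :
    tupleSum e k (fun a => ∑' j, φ j a) = ∑' j, tupleSum e k (φ j) :=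
  ENNReal.tsum_comm

lemma tupleSum_eq_zero {e : ι → A} {k : ℕ} {φ : A → ℝ≥0∞} :
    tupleSum e k φ = 0 ↔ ∀ i : Fin k → ι, φ (∑ j, e (i j)) = 0 :=
  ENNReal.tsum_eq_zero

lemma tupleSum_eq_apply_zero {e : ι → A} {k : ℕ} {φ : A → ℝ≥0∞} (hφ : ∀ a, φ a ≠ 0 → k = 0) :
    tupleSum e k φ = φ 0 := by
  rcases k with _ | k
  · exact tupleSum_zero e φ
  · have h0 : ∀ a, φ a = 0 := fun a => not_not.1 fun ha => k.succ_ne_zero (hφ a ha)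
    simp only [h0, tupleSum_eq_zero.2, implies_true]

lemma tupleSum_add (e : ι → A) (j k : ℕ) (φ : A → ℝ≥0∞) :
    tupleSum e (j + k) φ = tupleSum e j fun a => tupleSum e k fun b => φ (a + b) := by
  induction j generalizing φ with
  | zero => simp [tupleSum_zero]
  | succ j ih =>
    rw [Nat.succ_add]
    simp only [tupleSum_succ, ih, add_assoc]

lemma tupleSum_prod (e : ι → A) (f : κ → A) (n : ℕ) (φ : A → ℝ≥0∞) :
    tupleSum (fun i : ι × κ => e i.1 + f i.2) n φ =
      tupleSum e n fun a => tupleSum f n fun b => φ (a + b) := by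
  induction n generalizing φ with
  | zero => simp [tupleSum_zero]
  | succ n ih =>
    rw [tupleSum_succ, ENNReal.tsum_prod']
    simp only [ih, tupleSum_succ, tupleSum_fun_tsum, add_assoc, add_left_comm]

lemma tupleSum_pow (e : ι → A) (c : A →+ ℕ) (x : ℝ≥0∞) (k : ℕ) :
    tupleSum e k (fun a => x ^ c a) = (∑' i, x ^ c (e i)) ^ k := by
  induction k with
  | zero => simp [tupleSum_zero]
  | succ k ih =>
    simp only [tupleSum_succ, map_add, pow_add, tupleSum_const_mul, ih, ENNReal.tsum_mul_right]
    ring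

/-- Exchangeability: each of the `k + 1` terms has the same contribution to `γ`. -/
lemma tupleSum_succ_weight (e : ι → A) (γ : A →+ ℕ) (k : ℕ) (φ : A → ℝ≥0∞) :
    tupleSum e (k + 1) (fun a => γ a * φ a) =
      (k + 1 : ℕ) * ∑' i, γ (e i) * tupleSum e k fun a => φ (e i + a) := by
  induction k generalizing φ with
  | zero => simp [tupleSum_one, tupleSum_zero]
  | succ k ih =>
    rw [tupleSum_succ]
    simp only [map_add, Nat.cast_add, add_mul, tupleSum_fun_add, tupleSum_const_mul,
      ENNReal.tsum_add, ih fun a => φ (e _ + a), ENNReal.tsum_mul_left]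
    rw [ENNReal.tsum_comm]
    simp only [ENNReal.tsum_mul_left, tupleSum_succ, add_left_comm]
    push_cast
    ring

lemma tsum_option_ennreal (f : Option ι → ℝ≥0∞) : ∑' o, f o = f none + ∑' i, f (some i) := by
  rw [← (Equiv.optionEquivSumPUnit.{0} ι).symm.tsum_eq,
    ENNReal.summable.tsum_sum ENNReal.summable, add_comm]
  simp

/-- An `n`-tuple of optional terms is the choice of the occupied places and a tuple of terms; the
statistic `χ` counts the occupied places. -/
lemma tupleSum_option {e : ι → A} (χ : A →+ ℕ) (he : ∀ i, χ (e i) = 1) (n q : ℕ)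
    {φ : A → ℝ≥0∞} (hφ : ∀ a, φ a ≠ 0 → χ a = q) :
    tupleSum (fun o : Option ι => o.elim 0 e) n φ = n.choose q * tupleSum e q φ := by
  induction n generalizing q φ with
  | zero =>
    cases q with
    | zero => simp [tupleSum_zero]
    | succ q =>
      have h0 : φ 0 = 0 := by_contra fun h => by simpa using hφ 0 h
      simp [tupleSum_zero, h0]
  | succ n ih =>
    rw [tupleSum_succ, tsum_option_ennreal]
    simp only [Option.elim_none, zero_add, Option.elim_some, ih q hφ]
    have hχ : ∀ i a, φ (e i + a) ≠ 0 → χ a + 1 = q := fun i a h => by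
      rw [← hφ _ h, map_add, he, add_comm]
    cases q with
    | zero =>
      have h0 : ∀ i a, φ (e i + a) = 0 := fun i a => by_contra fun h => by
        simpa using hχ i a h
      simp [h0, tupleSum_eq_zero.2]
    | succ q =>
      simp only [fun i => ih q fun a h => Nat.succ_injective (hχ i a h), ENNReal.tsum_mul_left]
      rw [← tupleSum_succ, Nat.choose_succ_succ]
      push_cast
      ring

lemma tupleSum_option_prod {e : ι → A} {f : κ → A} (χ η : A →+ ℕ)
    (hχe : ∀ i, χ (e i) = 1) (hχf : ∀ i, χ (f i) = 0) (hηe : ∀ i, η (e i) = 0)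
    (hηf : ∀ i, η (f i) = 1) (n q r : ℕ) {φ : A → ℝ≥0∞}
    (hφ : ∀ a, φ a ≠ 0 → χ a = q ∧ η a = r) :
    tupleSum (fun o : Option ι × Option κ => o.1.elim 0 e + o.2.elim 0 f) n φ =
      n.choose q * (n.choose r * tupleSum e q fun a => tupleSum f r fun b => φ (a + b)) := by
  have hη : ∀ o : Option ι, η (o.elim 0 e) = 0 := fun o => by cases o <;> simp [hηe]
  have hinner : ∀ i : Fin n → Option ι,
      (tupleSum (fun o : Option κ => o.elim 0 f) n fun b => φ (∑ j, (i j).elim 0 e + b)) =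
        n.choose r * tupleSum f r fun b => φ (∑ j, (i j).elim 0 e + b) := fun i =>
    tupleSum_option η hηf n r fun b hb => by simpa [hη] using (hφ _ hb).2
  rw [tupleSum_prod (fun o : Option ι => o.elim 0 e) fun o : Option κ => o.elim 0 f]
  calc (tupleSum (fun o : Option ι => o.elim 0 e) n fun a =>
        tupleSum (fun o : Option κ => o.elim 0 f) n fun b => φ (a + b))
      = tupleSum (fun o : Option ι => o.elim 0 e) n fun a =>
          n.choose r * tupleSum f r fun b => φ (a + b) := tsum_congr hinner
    _ = n.choose q * tupleSum e q fun a => n.choose r * tupleSum f r fun b => φ (a + b) := by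
        refine tupleSum_option χ hχe n q fun a ha => ?_
        obtain ⟨i, hi⟩ := not_forall.1 (tupleSum_eq_zero.not.1 (right_ne_zero_of_mul ha))
        simpa [hχf] using (hφ _ hi).1
    _ = _ := by rw [tupleSum_const_mul]

section OtterDwass

variable {F : κ → A} {e : ι → A} {γ : A →+ ℕ}

lemma tupleSum_succ_of_split
    (h : ∀ φ : A → ℝ≥0∞, ∑' t, φ (F t) = ∑' i, tupleSum F (γ (e i)) fun a => φ (e i + a))
    (k : ℕ) (φ : A → ℝ≥0∞) :
    tupleSum F (k + 1) φ = ∑' i, tupleSum F (γ (e i) + k) fun a => φ (e i + a) := by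
  rw [tupleSum_succ, h fun b => tupleSum F k fun a => φ (b + a)]
  simp only [tupleSum_add, add_assoc]

lemma tupleSum_weight_add_mul {n k : ℕ} {φ : A → ℝ≥0∞} (hφ : ∀ a, φ a ≠ 0 → γ a + k = n) (l : ℕ) :
    tupleSum e l (fun a => γ a * φ a) + k * tupleSum e l φ = n * tupleSum e l φ := by
  rw [← tupleSum_const_mul, ← tupleSum_const_mul, ← tupleSum_fun_add]
  congr 1
  funext a
  by_cases ha : φ a = 0
  · simp [ha]
  · rw [← add_mul, ← hφ a ha, Nat.cast_add]

lemma tupleSum_cancel_weight {n k : ℕ} (hn : n ≠ 0) {φ : A → ℝ≥0∞}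
    (hφ : ∀ a, φ a ≠ 0 → γ a + k = n) {y : ℝ≥0∞}
    (hy : n * y = ∑' i, γ (e i) * tupleSum e n (fun a => φ (e i + a)) + k * tupleSum e (n + 1) φ) :
    (n + 1 : ℕ) * y = (k + 1 : ℕ) * tupleSum e (n + 1) φ := by
  rw [← ENNReal.mul_right_inj (a := n) (by simpa using hn) (by simp)]
  calc (n : ℝ≥0∞) * ((n + 1 : ℕ) * y)
      = (n + 1 : ℕ) * (∑' i, γ (e i) * tupleSum e n fun a => φ (e i + a))
          + (n + 1 : ℕ) * (k * tupleSum e (n + 1) φ) := by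
        rw [mul_left_comm, hy, mul_add]
    _ = n * tupleSum e (n + 1) φ + n * (k * tupleSum e (n + 1) φ) := by
        rw [← tupleSum_succ_weight, ← tupleSum_weight_add_mul hφ]
        push_cast
        ring
    _ = n * ((k + 1 : ℕ) * tupleSum e (n + 1) φ) := by
        push_cast
        ring

/-- The Otter–Dwass formula. If a term of the family `F` splits into a term `e i` together with
`γ (e i)` further terms of `F`, then sums over `k`-tuples of `F` made of `n` pieces reduce to sums
over `n`-tuples of pieces. -/
theorem tupleSum_otterDwass
    (h : ∀ φ : A → ℝ≥0∞, ∑' t, φ (F t) = ∑' i, tupleSum F (γ (e i)) fun a => φ (e i + a))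
    (n k : ℕ) {φ : A → ℝ≥0∞} (hφ : ∀ a, φ a ≠ 0 → γ a + k = n) :
    n * tupleSum F k φ = k * tupleSum e n φ := by
  have hφ0 : φ 0 ≠ 0 → k = n := fun h0 => by simpa using hφ 0 h0
  induction n generalizing k φ with
  | zero =>
    by_cases h0 : φ 0 = 0
    · simp [tupleSum_zero, h0]
    · simp [hφ0 h0]
  | succ n ih =>
    rcases k with _ | k
    · have h0 : φ 0 = 0 := not_not.1 fun h0 => n.succ_ne_zero (hφ0 h0).symm
      simp [tupleSum_zero, h0]
    have hstep := tupleSum_succ_of_split h k φ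
    have hsub : ∀ i a, φ (e i + a) ≠ 0 → γ a + (γ (e i) + k) = n := fun i a hi => by
      have := hφ _ hi
      rw [map_add] at this
      omega
    rcases n.eq_zero_or_pos with rfl | hn
    · have hpiece := fun i => tupleSum_eq_apply_zero (e := F) (φ := fun a => φ (e i + a))
        (k := γ (e i) + k) fun a ha => by have := hsub i a ha; omega
      simp only [hstep, hpiece, tupleSum_one, zero_add, add_zero]
      rcases k with _ | k
      · rfl
      · simp [fun a => not_not.1 fun ha : φ a ≠ 0 => by have := hφ a ha; omega]
    have hpieces : n * tupleSum F (k + 1) φ =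
        ∑' i, γ (e i) * tupleSum e n (fun a => φ (e i + a)) + k * tupleSum e (n + 1) φ := by
      simp only [hstep, ← ENNReal.tsum_mul_left, tupleSum_succ e n, ← ENNReal.tsum_add, ← add_mul]
      exact tsum_congr fun i => by
        rw [ih _ (hsub i) fun h0 => by simpa using hsub i 0 h0, Nat.cast_add]
    exact tupleSum_cancel_weight hn.ne' (fun a ha => Nat.succ_injective (hφ a ha)) hpieces

end OtterDwass

end TupleSum

section EdgesAndLabels

lemma mem_edgeTo {x y : ℤ} {t : BTree} {e : ℤ × ℤ} : e ∈ edgeTo x y t ↔ t ≠ .nil ∧ e = (x, y) := by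
  cases t <;> simp [edgeTo]

lemma edgeTo_of_ne_nil {t : BTree} (ht : t ≠ .nil) (x y : ℤ) : edgeTo x y t = {(x, y)} := by
  cases t with
  | nil => exact absurd rfl ht
  | node => rfl

lemma mem_edges_node {x : ℤ} {u : Unit} {l r : BTree} {e : ℤ × ℤ} :
    e ∈ edges x (.node u l r) ↔ (l ≠ .nil ∧ e = (x, x - 1) ∨ r ≠ .nil ∧ e = (x, x + 1)) ∨
      e ∈ edges (x - 1) l ∨ e ∈ edges (x + 1) r := by
  simp only [edges, Multiset.mem_add, mem_edgeTo]

lemma labels_eq_map (x y : ℤ) (t : BTree) :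
    labels y t = (edgeTo x y t + edges y t).map Prod.snd := by
  induction t generalizing x y with
  | nil => rfl
  | node u l r ihl ihr =>
    simp only [labels, edges, edgeTo, ihl y, ihr y, Multiset.map_add, Multiset.map_singleton,
      ← Multiset.singleton_add]
    abel

lemma labels_eq_cons {t : BTree} (ht : t ≠ .nil) (x : ℤ) :
    labels x t = x ::ₘ (edges x t).map Prod.snd := by
  rw [labels_eq_map x x, edgeTo_of_ne_nil ht, Multiset.singleton_add, Multiset.map_cons]

lemma card_labels (x : ℤ) (t : BTree) : (labels x t).card = t.numNodes := by
  induction t generalizing x with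
  | nil => rfl
  | node u l r ihl ihr => simp [labels, BinaryTree.numNodes, ihl, ihr]

lemma card_edges (x : ℤ) {t : BTree} (ht : t ≠ .nil) : (edges x t).card = numEdges t := by
  rw [numEdges, ← card_labels x, labels_eq_cons ht, Multiset.card_cons, Multiset.card_map,
    Nat.add_sub_cancel]

/-- The number of edges ending at a vertex with label `m`. -/
def arrivals (m : ℤ) : Multiset (ℤ × ℤ) →+ ℕ := Multiset.countPAddMonoidHom fun e => e.2 = m

lemma arrivals_apply (m : ℤ) (a : Multiset (ℤ × ℤ)) :
    arrivals m a = a.countP fun e => e.2 = m := rfl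

lemma arrivals_edges {m x : ℤ} (hx : x ≠ m) {t : BTree} (ht : t ≠ .nil) :
    arrivals m (edges x t) = (labels x t).count m := by
  rw [labels_eq_cons ht, Multiset.count_cons_of_ne hx.symm, Multiset.count_map, arrivals_apply,
    Multiset.countP_eq_card_filter]
  simp only [eq_comm]

end EdgesAndLabels

section Truncation

lemma truncate_eq_nil {d : ℤ} {t : BTree} : truncate d t = .nil ↔ t = .nil := by
  cases t with
  | nil => simp [truncate]
  | node u l r =>
    simp only [truncate]
    split_ifs <;> simp

lemma truncate_zero_eq_node {u : Unit} {t : BTree} :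
    truncate 0 t = .node u .nil .nil ↔ t ≠ .nil := by
  cases t <;> simp [truncate]

lemma truncate_truncate (d : ℤ) (t : BTree) : truncate d (truncate d t) = truncate d t := by
  induction t generalizing d with
  | nil => rfl
  | node u l r ihl ihr => by_cases h : d = 0 <;> simp [truncate, h, ihl, ihr]

lemma truncate_node_eq_self {d : ℤ} {u : Unit} {l r : BTree} :
    truncate d (.node u l r) = .node u l r ↔
      if d = 0 then l = .nil ∧ r = .nil else truncate (d - 1) l = l ∧ truncate (d + 1) r = r := by
  by_cases h : d = 0 <;> simp [truncate, h, eq_comm]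

lemma edgeTo_truncate (x y d : ℤ) (t : BTree) : edgeTo x y (truncate d t) = edgeTo x y t := by
  cases t with
  | nil => rfl
  | node u l r =>
    simp only [truncate]
    split_ifs <;> rfl

/-- The nonempty trees which, with root label `d`, have no strict descendants of vertices with
label `0`. -/
def truncated (d : ℤ) : Set BTree := {σ | σ ≠ .nil ∧ truncate d σ = σ}

lemma truncate_mem_truncated {d : ℤ} {t : BTree} (ht : t ≠ .nil) : truncate d t ∈ truncated d :=
  ⟨truncate_eq_nil.not.2 ht, truncate_truncate d t⟩

lemma ne_and_mem_of_mem_edges_of_truncate_eq_self {m : ℤ} {s : Set ℤ}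
    (hs : ∀ x ∈ s, x ≠ m → x - 1 ∈ s ∧ x + 1 ∈ s) {d : ℤ} {t : BTree} (hd : m + d ∈ s)
    (ht : truncate d t = t) : ∀ e ∈ edges (m + d) t, e.1 ≠ m ∧ e.1 ∈ s ∧ e.2 ∈ s := by
  induction t generalizing d with
  | nil => simp [edges]
  | node u l r ihl ihr =>
    intro e he
    rw [truncate_node_eq_self] at ht
    split_ifs at ht with h
    · simp [ht.1, ht.2, edges, edgeTo] at he
    · have hne : m + d ≠ m := by omega
      obtain ⟨hl, hr⟩ := hs _ hd hne
      simp only [mem_edges_node, add_sub_assoc, add_assoc] at he hl hr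
      rcases he with (⟨-, rfl⟩ | ⟨-, rfl⟩) | he | he
      · exact ⟨hne, hd, hl⟩
      · exact ⟨hne, hd, hr⟩
      · exact ihl hl ht.1 e he
      · exact ihr hr ht.2 e he

lemma truncate_eq_self_of_edges {m d : ℤ} {t : BTree} (h : ∀ e ∈ edges (m + d) t, e.1 ≠ m) :
    truncate d t = t := by
  induction t generalizing d with
  | nil => rfl
  | node u l r ihl ihr =>
    simp only [mem_edges_node, add_sub_assoc, add_assoc] at h
    rw [truncate_node_eq_self]
    split_ifs with hd
    · have hm : m + d = m := by omega
      exact ⟨by_contra fun hl => h _ (.inl (.inl ⟨hl, rfl⟩)) hm,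
        by_contra fun hr => h _ (.inl (.inr ⟨hr, rfl⟩)) hm⟩
    · exact ⟨ihl fun e he => h e (.inr (.inl he)), ihr fun e he => h e (.inr (.inr he))⟩

end Truncation

section Grafting

lemma tsum_tree (f : BTree → ℝ≥0∞) :
    ∑' t, f t = f .nil + ∑' lr : BTree × BTree, f (.node () lr.1 lr.2) := by
  let E : Option (BTree × BTree) ≃ BTree :=
    { toFun := fun o => o.elim .nil fun lr => .node () lr.1 lr.2
      invFun := fun t => match t with
        | .nil => none
        | .node _ l r => some (l, r)
      left_inv := by rintro (_ | ⟨l, r⟩) <;> rfl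
      right_inv := by rintro (_ | ⟨_, l, r⟩) <;> rfl }
  rw [← E.tsum_eq, tsum_option_ennreal]
  rfl

lemma tsum_nonempty_tree (f : BTree → ℝ≥0∞) :
    ∑' t : {t : BTree // t ≠ .nil}, f t = ∑' lr : BTree × BTree, f (.node () lr.1 lr.2) := by
  calc ∑' t : {t : BTree // t ≠ .nil}, f t = ∑' t, Set.indicator {t | t ≠ .nil} f t :=
        tsum_subtype {t : BTree | t ≠ .nil} f
    _ = _ := by simp [tsum_tree]

lemma tsum_tree' (f : BTree → ℝ≥0∞) :
    ∑' t, f t = f .nil + ∑' t : {t : BTree // t ≠ .nil}, f t := by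
  rw [tsum_tree, tsum_nonempty_tree]

/-- The edge multiset of a nonempty tree whose root has label `m`. -/
def treeEdges (m : ℤ) (t : {t : BTree // t ≠ .nil}) : Multiset (ℤ × ℤ) := edges m t

/-- The trees whose truncation is a tree with two given subtrees, when the root is not a vertex at
which the tree is cut. -/
def truncateFibreEquiv {d : ℤ} (hd : d ≠ 0) (u : Unit) (l r : BTree) :
    {t // truncate d t = .node u l r} ≃
      {t // truncate (d - 1) t = l} × {t // truncate (d + 1) t = r} where
  toFun t := match t with
    | ⟨.nil, h⟩ => by simp [truncate] at h
    | ⟨.node _ l' r', h⟩ => by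
      simp only [truncate, hd, if_false, BinaryTree.node.injEq] at h
      exact (⟨l', h.2.1⟩, ⟨r', h.2.2⟩)
  invFun lr := ⟨.node u lr.1 lr.2, by simp [truncate, hd, lr.1.2, lr.2.2]⟩
  left_inv := by
    rintro ⟨_ | ⟨_, l', r'⟩, h⟩
    · simp [truncate] at h
    · rfl
  right_inv _ := rfl

/-- A tree with given truncation `σ` at level `m` arises by grafting a tree at every vertex of `σ`
with label `m`. -/
lemma tsum_truncate_fibre (m : ℤ) {d : ℤ} {σ : BTree} (hσ : truncate d σ = σ)
    (φ : Multiset (ℤ × ℤ) → ℝ≥0∞) :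
    ∑' t : {t // truncate d t = σ}, φ (edges (m + d) t) =
      tupleSum (treeEdges m) ((labels (m + d) σ).count m) fun a => φ (edges (m + d) σ + a) := by
  induction σ generalizing d φ with
  | nil =>
    rw [tsum_eq_single (⟨.nil, rfl⟩ : {t // truncate d t = .nil}) fun t ht =>
      absurd (Subtype.ext (truncate_eq_nil.1 t.2)) ht]
    simp [labels, edges, tupleSum_zero]
  | node u l r ihl ihr =>
    rw [truncate_node_eq_self] at hσ
    split_ifs at hσ with hd
    · obtain ⟨rfl, rfl⟩ := hσ
      subst hd
      rw [← (Equiv.subtypeEquivRight fun t : BTree => truncate_zero_eq_node (u := u)).symm.tsum_eq]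
      simp [labels, edges, edgeTo, tupleSum_one, treeEdges]
    · have hcount : (labels (m + d) (.node u l r)).count m =
          (labels (m + (d - 1)) l).count m + (labels (m + (d + 1)) r).count m := by
        rw [labels, Multiset.count_cons_of_ne (by omega), Multiset.count_add, add_sub_assoc,
          add_assoc]
      rw [← (truncateFibreEquiv hd u l r).symm.tsum_eq, ENNReal.tsum_prod', hcount, tupleSum_add]
      set c := edgeTo (m + d) (m + d - 1) l + edgeTo (m + d) (m + d + 1) r with hc
      have hedges : ∀ (l' : {t // truncate (d - 1) t = l}) (r' : {t // truncate (d + 1) t = r}),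
          edges (m + d) ((truncateFibreEquiv hd u l r).symm (l', r')) =
            c + (edges (m + (d - 1)) l' + edges (m + (d + 1)) r') := by
        rintro ⟨l', rfl⟩ ⟨r', rfl⟩
        simp only [hc, edgeTo_truncate, ← add_sub_assoc, ← add_assoc (m : ℤ)]
        rfl
      simp only [hedges, fun a : Multiset (ℤ × ℤ) => ihr hσ.2 fun b => φ (c + (a + b))]
      rw [ihl hσ.1 fun a => tupleSum (treeEdges m) ((labels (m + (d + 1)) r).count m) fun b =>
        φ (c + (a + (edges (m + (d + 1)) r + b)))]
      simp only [edges, hc, add_sub_assoc, add_assoc, add_left_comm]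

/-- A nonempty tree is given by its truncation and a tree with this truncation. -/
def truncateSigmaEquiv (d : ℤ) :
    (Σ σ : truncated d, {t // truncate d t = σ}) ≃ {t : BTree // t ≠ .nil} where
  toFun σt := ⟨σt.2, fun h => σt.1.2.1 (by rw [← σt.2.2, h, truncate])⟩
  invFun t := ⟨⟨truncate d t, truncate_mem_truncated t.2⟩, ⟨t, rfl⟩⟩
  left_inv := by
    rintro ⟨⟨σ, hσ⟩, t, ht⟩
    obtain rfl : truncate d t = σ := ht
    rfl
  right_inv _ := rfl

lemma tsum_truncate (m d : ℤ) (φ : Multiset (ℤ × ℤ) → ℝ≥0∞) :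
    ∑' t : {t : BTree // t ≠ .nil}, φ (edges (m + d) t) =
      ∑' σ : truncated d, tupleSum (treeEdges m) ((labels (m + d) σ).count m)
        fun a => φ (edges (m + d) σ + a) := by
  rw [← (truncateSigmaEquiv d).tsum_eq, ENNReal.tsum_sigma']
  exact tsum_congr fun σ => tsum_truncate_fibre m σ.2.2 φ

/-- The edges of a truncated tree hanging from a vertex with label `m`, its root having label
`m + d`, including the edge that leads to its root. -/
def hangingEdges (m d : ℤ) (σ : truncated d) : Multiset (ℤ × ℤ) :=
  (m, m + d) ::ₘ edges (m + d) σ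

lemma arrivals_hangingEdges (m : ℤ) {d : ℤ} (hd : d ≠ 0) (σ : truncated d) :
    arrivals m (hangingEdges m d σ) = (labels (m + d) σ).count m := by
  rw [← arrivals_edges (by omega) σ.2.1, hangingEdges, arrivals_apply, arrivals_apply,
    Multiset.countP_cons_of_neg _ (by simpa using hd)]

lemma tsum_hangingEdges (m : ℤ) {d : ℤ} (hd : d ≠ 0) (φ : Multiset (ℤ × ℤ) → ℝ≥0∞) :
    ∑' t : BTree, φ (edgeTo m (m + d) t + edges (m + d) t) =
      ∑' o : Option (truncated d), tupleSum (treeEdges m)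
        (arrivals m (o.elim 0 (hangingEdges m d)))
          fun a => φ (o.elim 0 (hangingEdges m d) + a) := by
  rw [tsum_tree', tsum_option_ennreal]
  refine congrArg₂ (· + ·) (by simp [edgeTo, edges, tupleSum_zero]) ?_
  simp only [fun t : {t : BTree // t ≠ .nil} => edgeTo_of_ne_nil t.2 m (m + d),
    Option.elim_some, arrivals_hangingEdges m hd]
  simp only [hangingEdges, ← Multiset.singleton_add, add_assoc]
  exact tsum_truncate m d fun a => φ ({(m, m + d)} + a)

/-- The edges of the two optional subtrees of a vertex with label `m`, each cut at its vertices
with label `m`. -/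
def pieceEdges (m : ℤ) (o : Option (truncated (-1)) × Option (truncated 1)) : Multiset (ℤ × ℤ) :=
  o.1.elim 0 (hangingEdges m (-1)) + o.2.elim 0 (hangingEdges m 1)

/-- A tree with root label `m` splits into the part around its root that avoids the other vertices
with label `m`, and the trees hanging below it from vertices with label `m`. -/
lemma tsum_treeEdges (m : ℤ) (φ : Multiset (ℤ × ℤ) → ℝ≥0∞) :
    ∑' t, φ (treeEdges m t) =
      ∑' o, tupleSum (treeEdges m) (arrivals m (pieceEdges m o))
        fun a => φ (pieceEdges m o + a) := by
  have hedges : ∀ l r : BTree, edges m (.node () l r) =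
      edgeTo m (m + -1) l + edges (m + -1) l + (edgeTo m (m + 1) r + edges (m + 1) r) := by
    intro l r
    rw [edges, ← sub_eq_add_neg]
    abel
  simp only [treeEdges, pieceEdges]
  rw [tsum_nonempty_tree fun t => φ (edges m t), ENNReal.tsum_prod', ENNReal.tsum_prod']
  simp only [hedges,
    fun a : Multiset (ℤ × ℤ) => tsum_hangingEdges m one_ne_zero fun b => φ (a + b)]
  rw [tsum_hangingEdges m (d := -1) (by norm_num) fun a => ∑' o : Option (truncated 1),
    tupleSum (treeEdges m) (arrivals m (o.elim 0 (hangingEdges m 1)))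
      fun b => φ (a + (o.elim 0 (hangingEdges m 1) + b))]
  simp only [tupleSum_fun_tsum, map_add, tupleSum_add, add_assoc, add_left_comm]

end Grafting

section EdgesOn

/-- The multisets of edges between neighbouring labels, all of them in `s`. -/
def edgesOn (s : Set ℤ) : AddSubmonoid (Multiset (ℤ × ℤ)) where
  carrier := {a | ∀ e ∈ a, (e.2 = e.1 - 1 ∨ e.2 = e.1 + 1) ∧ e.1 ∈ s ∧ e.2 ∈ s}
  zero_mem' := by simp
  add_mem' ha hb e he := (Multiset.mem_add.1 he).elim (ha e) (hb e)

variable {s : Set ℤ} {m : ℤ} {a b : Multiset (ℤ × ℤ)}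

lemma mem_edgesOn :
    a ∈ edgesOn s ↔ ∀ e ∈ a, (e.2 = e.1 - 1 ∨ e.2 = e.1 + 1) ∧ e.1 ∈ s ∧ e.2 ∈ s := Iff.rfl

lemma add_mem_edgesOn : a + b ∈ edgesOn s ↔ a ∈ edgesOn s ∧ b ∈ edgesOn s := by
  simp only [mem_edgesOn, Multiset.mem_add, or_imp, ← forall_and]

lemma edgesOn_le_univ : edgesOn s ≤ edgesOn Set.univ :=
  fun _ ha e he => ⟨(ha e he).1, trivial, trivial⟩

lemma count_eq_zero_of_mem_edgesOn (ha : a ∈ edgesOn s) {e : ℤ × ℤ} (he : e.1 ∉ s ∨ e.2 ∉ s) :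
    a.count e = 0 :=
  Multiset.count_eq_zero.2 fun h => he.elim (· (ha e h).2.1) (· (ha e h).2.2)

lemma edges_mem_edgesOn_univ (x : ℤ) (t : BTree) : edges x t ∈ edgesOn Set.univ := by
  induction t generalizing x with
  | nil => exact AddSubmonoid.zero_mem _
  | node u l r ihl ihr =>
    intro e he
    rcases mem_edges_node.1 he with (⟨-, rfl⟩ | ⟨-, rfl⟩) | he | he
    · exact ⟨.inl rfl, trivial, trivial⟩
    · exact ⟨.inr rfl, trivial, trivial⟩
    · exact ihl _ e he
    · exact ihr _ e he

lemma countP_eq_add_of_iff_or {α : Type*} {p q r : α → Prop} [DecidablePred p] [DecidablePred q]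
    [DecidablePred r] {a : Multiset α} (h : ∀ e ∈ a, (p e ↔ q e ∨ r e) ∧ (q e → ¬r e)) :
    a.countP p = a.countP q + a.countP r := by
  induction a using Multiset.induction_on with
  | empty => rfl
  | cons e a ih =>
    have he := h e (Multiset.mem_cons_self e a)
    rw [Multiset.countP_cons, Multiset.countP_cons, Multiset.countP_cons,
      ih fun e' he' => h e' (Multiset.mem_cons_of_mem he')]
    split_ifs <;> grind

lemma arrivals_eq (m : ℤ) (ha : a ∈ edgesOn Set.univ) :
    arrivals m a = a.count (m - 1, m) + a.count (m + 1, m) :=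
  countP_eq_add_of_iff_or fun e he => by
    have := (ha e he).1
    rw [Prod.ext_iff, Prod.ext_iff]
    dsimp only
    omega

lemma hangingEdges_mem_edgesOn (hs : ∀ x ∈ s, x ≠ m → x - 1 ∈ s ∧ x + 1 ∈ s) (hm : m ∈ s) {d : ℤ}
    (hd : d = -1 ∨ d = 1) (hmd : m + d ∈ s) (σ : truncated d) : hangingEdges m d σ ∈ edgesOn s := by
  intro e he
  rcases Multiset.mem_cons.1 he with rfl | he
  · exact ⟨by dsimp only; omega, hm, hmd⟩
  · exact ⟨(edges_mem_edgesOn_univ _ _ e he).1,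
      (ne_and_mem_of_mem_edges_of_truncate_eq_self hs hmd σ.2.2 e he).2⟩

lemma hangingEdges_mem_low (m : ℤ) (σ : truncated (-1)) :
    hangingEdges m (-1) σ ∈ edgesOn (Set.Iic m) :=
  hangingEdges_mem_edgesOn (fun x hx hne => by simp only [Set.mem_Iic] at hx ⊢; omega)
    Set.self_mem_Iic (.inl rfl) (by simp) σ

lemma hangingEdges_mem_high (m : ℤ) (σ : truncated 1) :
    hangingEdges m 1 σ ∈ edgesOn (Set.Ici m) :=
  hangingEdges_mem_edgesOn (fun x hx hne => by simp only [Set.mem_Ici] at hx ⊢; omega)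
    Set.self_mem_Ici (.inr rfl) (by simp) σ

lemma count_hangingEdges (m y d : ℤ) (σ : truncated d) :
    (hangingEdges m d σ).count (m, y) = if y = m + d then 1 else 0 := by
  have h0 : (edges (m + d) σ).count (m, y) = 0 := Multiset.count_eq_zero.2 fun he =>
    (ne_and_mem_of_mem_edges_of_truncate_eq_self (s := Set.univ) (by simp) trivial σ.2.2 _ he).1 rfl
  simp [hangingEdges, Multiset.count_cons, h0]

/-- Counting forests of trees with root label `m` by the numbers `N` of vertices with label `m`,
`q` of left and `r` of right children of these. -/
lemma tupleSum_treeEdges (m : ℤ) (N k q r : ℕ) {ψ : Multiset (ℤ × ℤ) → ℝ≥0∞}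
    (hψ : ∀ a, ψ a ≠ 0 →
      arrivals m a + k = N ∧ a.count (m, m - 1) = q ∧ a.count (m, m + 1) = r) :
    N * tupleSum (treeEdges m) k ψ =
      k * (N.choose q * (N.choose r * tupleSum (hangingEdges m (-1)) q fun a =>
        tupleSum (hangingEdges m 1) r fun b => ψ (a + b))) := by
  rw [tupleSum_otterDwass (tsum_treeEdges m) N k fun a ha => (hψ a ha).1]
  congr 1
  refine tupleSum_option_prod (Multiset.countAddMonoidHom (m, m - 1))
    (Multiset.countAddMonoidHom (m, m + 1)) ?_ ?_ ?_ ?_ N q r fun a ha => (hψ a ha).2 <;>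
  · intro σ
    rw [Multiset.coe_countAddMonoidHom, count_hangingEdges]
    simp <;> omega

end EdgesOn

section LowEvents

/-- The number of `p`-tuples of excursions (trees with root label `1`, cut at their vertices with
label `0`) with altogether `q` vertices with label `0` and `l` edges. -/
def excursionCount (p q : ℕ) (l : ℤ) : ℝ≥0∞ :=
  tupleSum (fun τ : truncated 1 => (zeroCount τ, (numEdges τ : ℤ))) p (Set.indicator {(q, l)} 1)

/-- The numbers of edges from `m` to `m + 1` and from `m + 1` to `m`. -/
def crossings (m : ℤ) (a : Multiset (ℤ × ℤ)) : ℕ × ℕ := (a.count (m, m + 1), a.count (m + 1, m))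

/-- `L` is an event that only depends on the edges with a label below `m`, and that fixes the
number `u` of edges from `m - 1` to `m`, the number `q` of edges from `m` to `m - 1`, and the
number `w` of edges without label above `m`. -/
structure IsLowEvent (m : ℤ) (u q w : ℕ) (L : Set (Multiset (ℤ × ℤ))) : Prop where
  subset_edgesOn : L ⊆ edgesOn Set.univ
  add_mem_iff : ∀ a, ∀ b ∈ edgesOn (Set.Ici m), a + b ∈ L ↔ a ∈ L
  count_up : ∀ a ∈ L, a.count (m - 1, m) = u
  count_down : ∀ a ∈ L, a.count (m, m - 1) = q
  card_eq : ∀ a ∈ L, a ∈ edgesOn (Set.Iic m) → a.card = w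

variable {m : ℤ} {u q w : ℕ} {L : Set (Multiset (ℤ × ℤ))}

/-- The configurations with `l` edges. -/
def withCard (l : ℤ) : Set (Multiset (ℤ × ℤ)) := {a | (a.card : ℤ) = l}

lemma mem_withCard {l : ℤ} {a : Multiset (ℤ × ℤ)} : a ∈ withCard l ↔ (a.card : ℤ) = l := Iff.rfl

lemma count_labels_add (x c y : ℤ) (t : BTree) :
    (labels (x + c) t).count (y + c) = (labels x t).count y := by
  induction t generalizing x with
  | nil => rfl
  | node u l r ihl ihr =>
    simp [labels, add_sub_right_comm, add_right_comm x c 1, ihl, ihr, Multiset.count_cons]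

lemma count_hangingEdges_return (m : ℤ) (τ : truncated 1) :
    (hangingEdges m 1 τ).count (m + 1, m) = zeroCount τ := by
  have hup : (hangingEdges m 1 τ).count (m - 1, m) = 0 :=
    count_eq_zero_of_mem_edgesOn (hangingEdges_mem_high m τ) (.inl (by simp))
  have hshift : (labels (m + 1) τ).count m = zeroCount τ := by
    simpa [add_comm, zeroCount] using count_labels_add 1 m 0 τ
  rw [← hshift, ← arrivals_hangingEdges m one_ne_zero,
    arrivals_eq m (edgesOn_le_univ (hangingEdges_mem_high m τ)), hup, zero_add]

lemma card_hangingEdges (m d : ℤ) (σ : truncated d) :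
    (hangingEdges m d σ).card = numEdges σ + 1 := by
  rw [hangingEdges, Multiset.card_cons, card_edges _ σ.2.1]

lemma tupleSum_hangingEdges_one (m : ℤ) (r s : ℕ) (l : ℤ) :
    tupleSum (hangingEdges m 1) r
        ((withCard l ∩ crossings m ⁻¹' {(r, s)}).indicator 1) =
      excursionCount r s (l - r) := by
  refine tsum_congr fun τ => Set.indicator_eq_indicator (Eq.to_iff ?_) rfl
  simp only [Set.mem_inter_iff, mem_withCard, Set.mem_preimage, Set.mem_singleton_iff, crossings,
    Multiset.card_sum, Multiset.count_sum', count_hangingEdges_return, count_hangingEdges,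
    card_hangingEdges, Prod.ext_iff, Prod.fst_sum, Prod.snd_sum, if_true, Finset.sum_add_distrib,
    Finset.sum_const, Finset.card_univ, Fintype.card_fin, smul_eq_mul, mul_one, Nat.cast_add,
    Nat.cast_sum, true_and, eq_iff_iff]
  omega

namespace IsLowEvent

lemma tupleSum_high (hL : IsLowEvent m u q w L) {a : Multiset (ℤ × ℤ)}
    (ha : a ∈ edgesOn (Set.Iic m)) (r s : ℕ) (l : ℤ) :
    (tupleSum (hangingEdges m 1) r fun b =>
        (L ∩ withCard l ∩ crossings m ⁻¹' {(r, s)}).indicator 1 (a + b)) =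
      L.indicator 1 a * excursionCount r s (l - w - r) := by
  rw [← tupleSum_hangingEdges_one m, ← tupleSum_const_mul]
  refine tsum_congr fun τ => ?_
  beta_reduce
  have hb := AddSubmonoid.sum_mem _ fun j (_ : j ∈ Finset.univ) => hangingEdges_mem_high m (τ j)
  set b := ∑ j, hangingEdges m 1 (τ j)
  have hcross : crossings m (a + b) = crossings m b := by
    rw [crossings, crossings, Multiset.count_add, Multiset.count_add,
      count_eq_zero_of_mem_edgesOn ha (.inr (by simp)),
      count_eq_zero_of_mem_edgesOn ha (.inl (by simp)), zero_add, zero_add]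
  by_cases haL : a ∈ L
  · rw [Set.indicator_of_mem haL, Pi.one_apply, one_mul]
    refine Set.indicator_eq_indicator (Eq.to_iff ?_) rfl
    simp only [Set.mem_inter_iff, mem_withCard, Set.mem_preimage, Set.mem_singleton_iff,
      hL.add_mem_iff a b hb, haL, hcross, Multiset.card_add, hL.card_eq a haL ha, Nat.cast_add,
      eq_sub_iff_add_eq', true_and]
  · rw [Set.indicator_of_notMem haL, zero_mul, Set.indicator_of_notMem]
    exact fun h => haL ((hL.add_mem_iff a b hb).1 h.1.1)

lemma tupleSum_treeEdges (hL : IsLowEvent m u q w L) {c : Multiset (ℤ × ℤ)}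
    (hc : c ∈ edgesOn (Set.Iic m)) (hcd : c.count (m, m - 1) = 0) {N k r s : ℕ}
    (hN : N + arrivals m c = u + k + s) (l : ℤ) :
    (N * tupleSum (treeEdges m) k fun a =>
        (L ∩ withCard l ∩ crossings m ⁻¹' {(r, s)}).indicator 1 (c + a)) =
      k * (N.choose q * (N.choose r *
        ((tupleSum (hangingEdges m (-1)) q fun a => L.indicator 1 (c + a)) *
          excursionCount r s (l - w - r)))) := by
  have hlow (σ : Fin q → truncated (-1)) :
      c + ∑ j, hangingEdges m (-1) (σ j) ∈ edgesOn (Set.Iic m) :=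
    AddSubmonoid.add_mem _ hc (AddSubmonoid.sum_mem _ fun j _ => hangingEdges_mem_low m (σ j))
  rw [EdgeProfile.tupleSum_treeEdges m N k q r, ← tupleSum_mul_const]
  · congr 3
    refine tsum_congr fun σ => ?_
    simp only [← add_assoc, hL.tupleSum_high (hlow σ)]
  · intro a ha
    obtain ⟨⟨haL, -⟩, hz⟩ := Set.mem_of_indicator_ne_zero ha
    rw [Set.mem_preimage, Set.mem_singleton_iff, crossings, Prod.mk.injEq, Multiset.count_add,
      Multiset.count_add, count_eq_zero_of_mem_edgesOn hc (.inr (by simp)),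
      count_eq_zero_of_mem_edgesOn hc (.inl (by simp)), zero_add, zero_add] at hz
    have harr := arrivals_eq m (hL.subset_edgesOn haL)
    have hdown := hL.count_down _ haL
    rw [map_add, hL.count_up _ haL, Multiset.count_add,
      count_eq_zero_of_mem_edgesOn hc (.inl (by simp)), zero_add, hz.2] at harr
    rw [Multiset.count_add, hcd, zero_add] at hdown
    exact ⟨by omega, hdown, hz.1⟩

end IsLowEvent

end LowEvents

section Excursions

lemma tsum_comp_pi {ι κ : Type*} {k : ℕ} {g : κ → ι} (hg : g.Injective) {F : (Fin k → ι) → ℝ≥0∞}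
    (hF : ∀ i, F i ≠ 0 → ∀ j, i j ∈ Set.range g) :
    ∑' i : Fin k → κ, F (g ∘ i) = ∑' i, F i := by
  refine (hg.comp_left (α := Fin k)).tsum_eq fun i hi => ?_
  choose i' hi' using hF i hi
  exact ⟨i', funext hi'⟩

lemma tsum_indicator_inter_preimage {α β : Type*} (S : Set α) (g : α → β) (a : α) :
    ∑' z, (S ∩ g ⁻¹' {z}).indicator (1 : α → ℝ≥0∞) a = S.indicator 1 a := by
  rw [tsum_eq_single (g a) fun z hz => Set.indicator_of_notMem (fun h => hz h.2.symm) _]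
  exact Set.indicator_eq_indicator (by simp) rfl

/-- The part of the transition probabilities that comes from the Otter–Dwass formula: `p + s` is
the number of vertices with a given label, `q` and `r` are the numbers of their left and right
children. -/
def stepWeight (p q r s : ℕ) : ℝ≥0∞ := (p + s).choose q * (p + s).choose r / (p + s : ℕ)

namespace IsLowEvent

variable {m : ℤ} {u q w : ℕ} {L : Set (Multiset (ℤ × ℤ))}

lemma tupleSum_treeEdges_eq (hL : IsLowEvent m u q w L) {c : Multiset (ℤ × ℤ)}
    (hc : c ∈ edgesOn (Set.Iic m)) (hcd : c.count (m, m - 1) = 0) {p k : ℕ} (hp : p ≠ 0)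
    (hk : p + arrivals m c = u + k) (r s : ℕ) (l : ℤ) :
    (tupleSum (treeEdges m) k fun a =>
        (L ∩ withCard l ∩ crossings m ⁻¹' {(r, s)}).indicator 1 (c + a)) =
      stepWeight p q r s *
        (k * tupleSum (hangingEdges m (-1)) q fun a => L.indicator 1 (c + a)) *
          excursionCount r s (l - w - r) := by
  have h := hL.tupleSum_treeEdges hc hcd (N := p + s) (k := k) (r := r) (s := s) (by omega) l
  have hN : ((p + s : ℕ) : ℝ≥0∞) ≠ 0 := Nat.cast_ne_zero.2 (by omega)
  have hinv := ENNReal.mul_inv_cancel hN (ENNReal.natCast_ne_top _)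
  refine (ENNReal.mul_right_inj hN (ENNReal.natCast_ne_top _)).1 (h.trans ?_)
  rw [← one_mul (k * _ : ℝ≥0∞), ← hinv, stepWeight, div_eq_mul_inv]
  ring

end IsLowEvent

/-- The excursions, as an event: no edge starts from a label below `1`, and `q` edges lead to a
vertex with label `0`. -/
def excursionEvent (q : ℕ) : Set (Multiset (ℤ × ℤ)) :=
  {a | a ∈ edgesOn Set.univ ∧ (∀ e ∈ a, 1 ≤ e.1) ∧ a.count (1, 0) = q}

lemma isLowEvent_excursionEvent (q : ℕ) : IsLowEvent 1 0 q q (excursionEvent q) where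
  subset_edgesOn _ ha := ha.1
  add_mem_iff a b hb := by
    have hcount : b.count (1, 0) = 0 := count_eq_zero_of_mem_edgesOn hb (.inr (by simp))
    have hge : (∀ e ∈ b, 1 ≤ e.1) ↔ True := iff_true_intro fun e he => (hb e he).2.1
    simp only [excursionEvent, Set.mem_ofPred_eq, add_mem_edgesOn, edgesOn_le_univ hb, and_true,
      Multiset.mem_add, or_imp, forall_and, hge, Multiset.count_add, hcount, add_zero]
  count_up a ha := Multiset.count_eq_zero.2 fun he => absurd (ha.2.1 _ he) (by norm_num)
  count_down a ha := ha.2.2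
  card_eq a ha hlow := by
    have hall : ∀ e ∈ a, (1, 0) = e := fun e he => by
      have h1 := ha.2.1 e he
      obtain ⟨hadj, h2, h3⟩ := hlow e he
      rw [Set.mem_Iic] at h2 h3
      rw [Prod.ext_iff]
      dsimp only
      omega
    rw [← ha.2.2, Multiset.count_eq_card.2 hall]

lemma mem_truncated_one {t : BTree} (ht : t ≠ .nil) :
    t ∈ truncated 1 ↔ ∀ e ∈ edges 1 t, 1 ≤ e.1 := by
  refine ⟨fun h e he => ?_, fun h => ⟨ht, truncate_eq_self_of_edges (m := 0) ?_⟩⟩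
  · have := ne_and_mem_of_mem_edges_of_truncate_eq_self (m := 0) (s := Set.Ici 0) (d := 1)
      (fun x hx hne => by simp only [Set.mem_Ici] at hx ⊢; omega) (by simp) h.2 e
      (by simpa using he)
    have h0 := Set.mem_Ici.1 this.2.1
    have := this.1
    omega
  · rw [zero_add]
    exact fun e he => (zero_lt_one.trans_le (h e he)).ne'

lemma zeroCount_eq_count {τ : BTree} (hτ : τ ∈ truncated 1) :
    zeroCount τ = (edges 1 τ).count (1, 0) := by
  have hup : (edges 1 τ).count (-1, 0) = 0 := Multiset.count_eq_zero.2 fun he =>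
    absurd ((mem_truncated_one hτ.1).1 hτ _ he) (by norm_num)
  have h := arrivals_eq 0 (edges_mem_edgesOn_univ 1 τ)
  rw [arrivals_edges one_ne_zero hτ.1] at h
  simpa [hup, zeroCount] using h

lemma excursionCount_eq_tupleSum (p q : ℕ) (l : ℤ) :
    excursionCount p q l =
      tupleSum (treeEdges 1) p ((excursionEvent q ∩ withCard l).indicator 1) := by
  have hinj : Function.Injective fun τ : truncated 1 => (⟨τ, τ.2.1⟩ : {t : BTree // t ≠ .nil}) :=
    fun τ τ' h => Subtype.ext (Subtype.mk.inj h)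
  rw [tupleSum, ← tsum_comp_pi hinj]
  · refine tsum_congr fun τ => Set.indicator_eq_indicator (Eq.to_iff ?_) rfl
    have hmem : ∑ j, edges 1 (τ j) ∈ edgesOn Set.univ :=
      AddSubmonoid.sum_mem _ fun j _ => edges_mem_edgesOn_univ 1 (τ j)
    have hge : (∀ e ∈ ∑ j, edges 1 (τ j), 1 ≤ e.1) ↔ True := iff_true_intro fun e he => by
      obtain ⟨j, -, hj⟩ := Multiset.mem_sum.1 he
      exact (mem_truncated_one (τ j).2.1).1 (τ j).2 e hj
    simp only [Function.comp_apply, treeEdges, Set.mem_inter_iff, mem_withCard, excursionEvent,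
      Set.mem_ofPred_eq, hmem, hge, Multiset.count_sum', Multiset.card_sum,
      fun j => card_edges 1 (τ j).2.1, fun j => zeroCount_eq_count (τ j).2,
      Set.mem_singleton_iff, Prod.ext_iff, Prod.fst_sum, Prod.snd_sum, Nat.cast_sum, true_and]
  · intro t ht j
    have hmem := (Set.mem_of_indicator_ne_zero ht).1.2.1
    refine ⟨⟨t j, (mem_truncated_one (t j).2).2 fun e he => hmem e ?_⟩, rfl⟩
    exact Multiset.mem_sum.2 ⟨j, Finset.mem_univ j, he⟩

lemma tupleSum_hangingEdges_excursionEvent (q : ℕ) :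
    (tupleSum (hangingEdges 1 (-1)) q fun a => (excursionEvent q).indicator 1 a) = 1 := by
  let leaf : truncated (-1) := ⟨.node () .nil .nil, by simp, by simp [truncate]⟩
  rw [tupleSum, tsum_eq_single fun _ => leaf]
  · refine Set.indicator_of_mem ?_ _
    have hleaf : ∑ _ : Fin q, hangingEdges 1 (-1) leaf = Multiset.replicate q (1, 0) := by
      simp [hangingEdges, leaf, edges, edgeTo, Multiset.nsmul_singleton]
    rw [hleaf]
    refine ⟨fun e he => ?_, fun e he => ?_, Multiset.count_replicate_self _ _⟩ <;>
    · obtain rfl := Multiset.eq_of_mem_replicate he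
      simp
  · intro σ hσ
    refine Set.indicator_of_notMem (fun h => hσ (funext fun j => Subtype.ext ?_)) _
    have hge : ∀ e ∈ edges 0 (σ j), 1 ≤ e.1 := fun e he => h.2.1 e <|
      Multiset.mem_sum.2 ⟨j, Finset.mem_univ j, Multiset.mem_cons_of_mem he⟩
    have hne := (σ j).2.1
    generalize (σ j : BTree) = t at hge hne ⊢
    cases t with
    | nil => exact absurd rfl hne
    | node _ l r =>
      simp only [mem_edges_node] at hge
      have hl : l = .nil := by_contra fun hl => absurd (hge _ (.inl (.inl ⟨hl, rfl⟩))) (by simp)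
      have hr : r = .nil := by_contra fun hr => absurd (hge _ (.inl (.inr ⟨hr, rfl⟩))) (by simp)
      rw [hl, hr]

lemma excursionCount_eq_tsum {p : ℕ} (hp : p ≠ 0) (q : ℕ) (l : ℤ) :
    excursionCount p q l = ∑' z : ℕ × ℕ,
      stepWeight p q z.1 z.2 * p * excursionCount z.1 z.2 (l - q - z.1) := by
  have hstep (z : ℕ × ℕ) := (isLowEvent_excursionEvent q).tupleSum_treeEdges_eq (c := 0)
    (AddSubmonoid.zero_mem _) rfl hp (by rw [map_zero, add_zero, zero_add]) z.1 z.2 l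
  simp only [zero_add, tupleSum_hangingEdges_excursionEvent, mul_one] at hstep
  simp only [excursionCount_eq_tupleSum p q l, ← hstep, ← tupleSum_fun_tsum,
    tsum_indicator_inter_preimage]

end Excursions

section TreeCount

variable {m : ℤ} {p q v w : ℕ} {L : Set (Multiset (ℤ × ℤ))}

/-- The number of trees with root label `0` and `V` edges whose edge multiset lies in `L`. -/
def treeCount (V : ℕ) (L : Set (Multiset (ℤ × ℤ))) : ℝ≥0∞ :=
  ∑' t : {t : BTree // t ≠ .nil}, (L ∩ withCard V).indicator 1 (edges 0 t)

/-- The contribution to `treeCount` of the part of the tree below label `m`, when `q` edges lead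
from `m` to `m - 1`. -/
def lowerWeight (m : ℤ) (q : ℕ) (L : Set (Multiset (ℤ × ℤ))) : ℝ≥0∞ :=
  ∑' σ : truncated (-m), arrivals m (edges 0 σ) *
    tupleSum (hangingEdges m (-1)) q fun a => L.indicator 1 (edges 0 σ + a)

lemma truncated_mem_low (hm : 0 < m) (σ : truncated (-m)) : edges 0 σ ∈ edgesOn (Set.Iic m) :=
  fun e he => ⟨(edges_mem_edgesOn_univ 0 _ e he).1,
    (ne_and_mem_of_mem_edges_of_truncate_eq_self (m := m) (s := Set.Iic m) (d := -m)
      (fun x hx hne => by simp only [Set.mem_Iic] at hx ⊢; omega) (by simpa using hm.le) σ.2.2 e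
      (by simpa using he)).2⟩

lemma count_truncated_down (m : ℤ) (σ : truncated (-m)) : (edges 0 σ).count (m, m - 1) = 0 :=
  Multiset.count_eq_zero.2 fun he =>
    (ne_and_mem_of_mem_edges_of_truncate_eq_self (m := m) (s := Set.univ) (d := -m)
      (by simp) trivial σ.2.2 _ (by simpa using he)).1 rfl

lemma treeCount_inter_crossings (hm : 0 < m) (hp : p ≠ 0) (hL : IsLowEvent m p q w L)
    (V r s : ℕ) :
    treeCount V (L ∩ crossings m ⁻¹' {(r, s)}) =
      stepWeight p q r s * lowerWeight m q L * excursionCount r s (V - w - r) := by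
  have h := tsum_truncate m (-m) ((L ∩ withCard V ∩ crossings m ⁻¹' {(r, s)}).indicator 1)
  simp only [add_neg_cancel] at h
  rw [treeCount, Set.inter_right_comm, h, lowerWeight, ← ENNReal.tsum_mul_left,
    ← ENNReal.tsum_mul_right]
  refine tsum_congr fun σ => ?_
  rw [← arrivals_edges hm.ne σ.2.1]
  exact hL.tupleSum_treeEdges_eq (truncated_mem_low hm σ) (count_truncated_down m σ) hp rfl r s V

lemma mul_treeCount (hm : 0 < m) (hp : p ≠ 0) (hL : IsLowEvent m p q (v + p + q) L) (V : ℕ) :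
    p * treeCount V L = lowerWeight m q L * excursionCount p q (V - v - p) := by
  have hz (z : ℕ × ℕ) := treeCount_inter_crossings hm hp hL V z.1 z.2
  have hsplit : treeCount V L = ∑' z, treeCount V (L ∩ crossings m ⁻¹' {z}) := by
    simp only [treeCount, Set.inter_right_comm]
    rw [ENNReal.tsum_comm]
    simp only [tsum_indicator_inter_preimage]
  rw [hsplit, excursionCount_eq_tsum hp, ← ENNReal.tsum_mul_left, ← ENNReal.tsum_mul_left]
  refine tsum_congr fun z => ?_
  rw [hz z, show (V - v - p - q : ℤ) = V - (v + p + q : ℕ) by push_cast; ring]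
  ring

end TreeCount

section Profile

/-- The triple `(X_m^+, X_m^-, M_m^-)` as a function of the multiset of edges. -/
def edgeProfile (m : ℕ) (a : Multiset (ℤ × ℤ)) : ℕ × ℕ × ℕ :=
  (a.count ((m : ℤ) - 1, (m : ℤ)), a.count ((m : ℤ), (m : ℤ) - 1),
    a.countP fun e => e.1 ≤ (m : ℤ) - 1 ∧ e.2 ≤ (m : ℤ) - 1)

lemma edgeProfile_add_high {m k : ℕ} (hk : k ≤ m) (a : Multiset (ℤ × ℤ)) {b : Multiset (ℤ × ℤ)}
    (hb : b ∈ edgesOn (Set.Ici (m : ℤ))) : edgeProfile k (a + b) = edgeProfile k a := by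
  have hmass : (b.countP fun e => e.1 ≤ (k : ℤ) - 1 ∧ e.2 ≤ (k : ℤ) - 1) = 0 :=
    Multiset.countP_eq_zero.2 fun e he h => by
      have := Set.mem_Ici.1 (hb e he).2.1
      omega
  simp only [edgeProfile, Multiset.count_add, Multiset.countP_add, hmass, add_zero,
    count_eq_zero_of_mem_edgesOn hb (e := ((k : ℤ) - 1, (k : ℤ))) (.inl (by simp; omega)),
    count_eq_zero_of_mem_edgesOn hb (e := ((k : ℤ), (k : ℤ) - 1)) (.inr (by simp; omega))]

lemma countP_le_eq (m : ℤ) {a : Multiset (ℤ × ℤ)} (ha : a ∈ edgesOn Set.univ) :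
    (a.countP fun e => e.1 ≤ m ∧ e.2 ≤ m) =
      (a.countP fun e => e.1 ≤ m - 1 ∧ e.2 ≤ m - 1) + a.count (m - 1, m) + a.count (m, m - 1) := by
  rw [add_assoc]
  have hcross : (a.countP fun e => (m - 1, m) = e ∨ (m, m - 1) = e) =
      a.count (m - 1, m) + a.count (m, m - 1) :=
    countP_eq_add_of_iff_or fun e _ => ⟨Iff.rfl, by grind⟩
  rw [← hcross]
  refine countP_eq_add_of_iff_or fun e he => ?_
  have := (ha e he).1
  rw [Prod.ext_iff, Prod.ext_iff]
  dsimp only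
  omega

lemma edgeProfile_succ (m : ℕ) {a : Multiset (ℤ × ℤ)} (ha : a ∈ edgesOn Set.univ) :
    edgeProfile (m + 1) a = ((crossings m a).1, (crossings m a).2,
      (edgeProfile m a).2.2 + (edgeProfile m a).1 + (edgeProfile m a).2.1) := by
  simp only [edgeProfile, crossings, Nat.cast_add, Nat.cast_one, add_sub_cancel_right,
    ← countP_le_eq (m : ℤ) ha]

lemma card_of_mem_low {m : ℕ} {a : Multiset (ℤ × ℤ)} (ha : a ∈ edgesOn (Set.Iic (m : ℤ))) :
    a.card = (edgeProfile m a).2.2 + (edgeProfile m a).1 + (edgeProfile m a).2.1 :=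
  (Multiset.countP_eq_card.2 fun e he => (ha e he).2).symm.trans
    (countP_le_eq (m : ℤ) (edgesOn_le_univ ha))

lemma edgeProfile_succ_of_full {m : ℕ} {a : Multiset (ℤ × ℤ)} (ha : a ∈ edgesOn Set.univ)
    (h : edgeProfile m a = (0, 0, a.card)) : edgeProfile (m + 1) a = (0, 0, a.card) := by
  have hlow := Multiset.countP_eq_card.1 (congrArg (fun x => x.2.2) h)
  have hzero : ∀ e : ℤ × ℤ, (m : ℤ) ≤ e.1 → a.count e = 0 := fun e he =>
    Multiset.count_eq_zero.2 fun hmem => by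
      have := (hlow e hmem).1
      omega
  rw [edgeProfile_succ m ha, h, crossings, hzero _ le_rfl, hzero _ (by simp)]
  simp

end Profile

section Laws

/-- The probability of a nonempty tree under `treeLaw`. -/
def treeWeight (t : BTree) : ℝ≥0∞ := 4⁻¹ ^ t.numNodes

lemma treeWeight_nil : treeWeight .nil = 1 := pow_zero _

lemma treeWeight_node (l r : BTree) :
    treeWeight (.node () l r) = 4⁻¹ * (treeWeight l * treeWeight r) := by
  rw [treeWeight, BinaryTree.numNodes, pow_succ', pow_add]
  rfl

lemma four_inv_mul_four : (4 : ℝ≥0∞)⁻¹ * 4 = 1 := ENNReal.inv_mul_cancel (by simp) (by simp)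

lemma treeWeight_of_ne_nil {t : BTree} (ht : t ≠ .nil) : treeWeight t = 4⁻¹ ^ (numEdges t + 1) := by
  cases t with
  | nil => exact absurd rfl ht
  | node a l r => rw [treeWeight, numEdges, BinaryTree.numNodes, Nat.add_sub_cancel]

lemma tsum_treeWeight_height_le (n : ℕ) :
    ∑' t : BTree, {t | t.height ≤ n}.indicator treeWeight t ≤ 2 := by
  induction n with
  | zero => simp [tsum_tree, Set.indicator, BinaryTree.height, treeWeight_nil]
  | succ n ih =>
    have hnode (l r : BTree) :
        {t | t.height ≤ n + 1}.indicator treeWeight (.node () l r) =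
          4⁻¹ * ({t | t.height ≤ n}.indicator treeWeight l *
            {t | t.height ≤ n}.indicator treeWeight r) := by
      by_cases hl : l.height ≤ n <;> by_cases hr : r.height ≤ n <;>
        simp [Set.indicator_apply, BinaryTree.height, hl, hr, treeWeight_node]
    rw [tsum_tree, ENNReal.tsum_prod', Set.indicator_of_mem (by simp [BinaryTree.height]),
      treeWeight_nil]
    simp only [hnode, ENNReal.tsum_mul_left, ENNReal.tsum_mul_right]
    calc (1 : ℝ≥0∞) + 4⁻¹ * (_ * _) ≤ 1 + 4⁻¹ * (2 * 2) := by gcongr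
      _ = 2 := by
        rw [show (2 : ℝ≥0∞) * 2 = 4 by norm_num, four_inv_mul_four, one_add_one_eq_two]

lemma tsum_treeWeight_le : ∑' t, treeWeight t ≤ 2 := by
  refine ENNReal.summable.tsum_le_of_sum_le fun s => ?_
  calc ∑ t ∈ s, treeWeight t
      = ∑ t ∈ s, {t | t.height ≤ s.sup BinaryTree.height}.indicator treeWeight t :=
        Finset.sum_congr rfl fun t ht => by
          rw [Set.indicator_of_mem]
          exact Finset.le_sup (f := BinaryTree.height) ht
    _ ≤ _ := ENNReal.sum_le_tsum s
    _ ≤ 2 := tsum_treeWeight_height_le _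

lemma tsum_treeWeight : ∑' t, treeWeight t = 2 := by
  have hrec : ∑' t, treeWeight t = 1 + 4⁻¹ * ((∑' t, treeWeight t) * ∑' t, treeWeight t) := by
    conv_lhs => rw [tsum_tree, ENNReal.tsum_prod', treeWeight_nil]
    simp only [treeWeight_node, ENNReal.tsum_mul_left, ENNReal.tsum_mul_right]
  have hfin : ∑' t, treeWeight t ≠ ⊤ := ne_top_of_le_ne_top (by simp) tsum_treeWeight_le
  have hreal := congrArg ENNReal.toReal hrec
  rw [ENNReal.toReal_add (by simp) (by finiteness), ENNReal.toReal_mul, ENNReal.toReal_mul,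
    ENNReal.toReal_inv] at hreal
  rw [← ENNReal.toReal_eq_toReal_iff' hfin (by simp)]
  norm_num at hreal ⊢
  nlinarith [sq_nonneg ((∑' t, treeWeight t).toReal - 2)]

lemma tsum_nonempty_treeWeight : ∑' t : {t : BTree // t ≠ .nil}, treeWeight t = 1 := by
  have h := tsum_tree' treeWeight
  rw [tsum_treeWeight, treeWeight_nil, ← one_add_one_eq_two] at h
  exact ((ENNReal.add_right_inj (by simp)).1 h).symm

lemma tsum_inv_four_pow_card (m : ℤ) : ∑' t, (4 : ℝ≥0∞)⁻¹ ^ (treeEdges m t).card = 4 := by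
  have h (t : {t : BTree // t ≠ .nil}) :
      (4 : ℝ≥0∞)⁻¹ ^ (treeEdges m t).card = 4 * treeWeight t := by
    rw [treeEdges, card_edges m t.2, treeWeight_of_ne_nil t.2, pow_succ', ← mul_assoc,
      mul_comm 4, four_inv_mul_four, one_mul]
  simp only [h, ENNReal.tsum_mul_left, tsum_nonempty_treeWeight, mul_one]

instance : Countable BTree :=
  (Set.countable_univ_iff.1 <| (Set.countable_iUnion fun n =>
    (BinaryTree.treesOfNumNodesEq n).countable_toSet).mono fun t _ =>
      Set.mem_iUnion.2 ⟨t.numNodes, BinaryTree.mem_treesOfNumNodesEq.2 rfl⟩)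

instance : DiscreteMeasurableSpace BTree := ⟨fun _ => trivial⟩

lemma treeLaw_apply (s : Set BTree) :
    treeLaw s = ∑' t : {t : BTree // t ≠ .nil}, s.indicator treeWeight t := by
  rw [treeLaw, Measure.sum_apply _ .of_discrete]
  refine tsum_congr fun t => ?_
  rw [Measure.smul_apply, Measure.dirac_apply' _ .of_discrete, smul_eq_mul,
    ← treeWeight_of_ne_nil t.2]
  by_cases h : (t : BTree) ∈ s <;> simp [h]

lemma excursionLaw_apply (s : Set BTree) : excursionLaw s = treeLaw (truncate 1 ⁻¹' s) :=
  Measure.map_apply measurable_from_top .of_discrete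

instance : IsProbabilityMeasure excursionLaw := by
  constructor
  simp only [excursionLaw_apply, treeLaw_apply, Set.preimage_univ, Set.indicator_univ,
    tsum_nonempty_treeWeight]

lemma excursionLaw_singleton_of_notMem {t : BTree} (ht : t ∉ truncated 1) :
    excursionLaw {t} = 0 := by
  rw [excursionLaw_apply, treeLaw_apply, ENNReal.tsum_eq_zero]
  refine fun t' => Set.indicator_of_notMem (fun h => ht ?_) _
  rw [← Set.mem_singleton_iff.1 (Set.mem_preimage.1 h)]
  exact truncate_mem_truncated t'.2

/-- The trees grafted at the `n_τ` vertices with label `0` have total weight `4` each. -/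
lemma excursionLaw_singleton (τ : truncated 1) :
    excursionLaw {τ.1} = 4 ^ zeroCount τ * treeWeight τ := by
  have hnil : .nil ∉ truncate 1 ⁻¹' {τ.1} := fun h => τ.2.1 h.symm
  calc excursionLaw {τ.1} = ∑' t : {t // truncate 1 t = τ}, treeWeight t := by
        have h := tsum_tree' ((truncate 1 ⁻¹' {τ.1}).indicator treeWeight)
        rw [Set.indicator_of_notMem hnil, zero_add] at h
        rw [excursionLaw_apply, treeLaw_apply, ← h]
        exact (tsum_subtype (truncate 1 ⁻¹' {τ.1}) treeWeight).symm
    _ = ∑' t : {t // truncate 1 t = τ}, (4 : ℝ≥0∞)⁻¹ ^ ((edges (0 + 1) t).card + 1) :=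
      tsum_congr fun t => by
        have ht : t.1 ≠ .nil := fun h => hnil (h ▸ t.2)
        rw [card_edges _ ht, treeWeight_of_ne_nil ht]
    _ = 4 ^ zeroCount τ * treeWeight τ := by
      rw [tsum_truncate_fibre 0 τ.2.2 fun a => (4 : ℝ≥0∞)⁻¹ ^ (a.card + 1)]
      simp only [Multiset.card_add, card_edges _ τ.2.1, add_right_comm _ _ 1]
      simp only [pow_add _ (numEdges τ.1 + 1), tupleSum_const_mul,
        ← treeWeight_of_ne_nil τ.2.1]
      have hpow := tupleSum_pow (treeEdges 0) Multiset.cardHom 4⁻¹ ((labels (0 + 1) τ.1).count 0)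
      simp only [Multiset.cardHom_apply, tsum_inv_four_pow_card] at hpow
      rw [hpow, mul_comm, zero_add, zeroCount]

lemma prod_excursionLaw_singleton {p : ℕ} (τ : Fin p → truncated 1) :
    ∏ k, excursionLaw {(τ k).1} =
      4 ^ ((∑ k, zeroCount (τ k) : ℕ) - (∑ k, numEdges (τ k) : ℕ) - p : ℤ) := by
  simp only [excursionLaw_singleton, fun k => treeWeight_of_ne_nil (τ k).2.1,
    Finset.prod_mul_distrib, Finset.prod_pow_eq_pow_sum, Finset.sum_add_distrib]
  rw [sub_sub, ENNReal.zpow_sub (by simp) (by simp), zpow_natCast, ← Nat.cast_add,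
    zpow_natCast, ← ENNReal.inv_pow]
  simp

lemma pi_excursionLaw_apply (p q : ℕ) (l : ℤ) :
    (Measure.pi fun _ : Fin p => excursionLaw)
        {τ | ∑ k, zeroCount (τ k) = q ∧ ((∑ k, numEdges (τ k) : ℕ) : ℤ) = l} =
      4 ^ (q - l - p) * excursionCount p q l := by
  rw [← Measure.tsum_indicator_apply_singleton _ _ .of_discrete, excursionCount, tupleSum,
    ← ENNReal.tsum_mul_left,
    ← tsum_comp_pi (g := ((↑) : truncated 1 → BTree)) Subtype.val_injective]
  · refine tsum_congr fun τ => ?_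
    simp only [Set.indicator_apply, Set.mem_ofPred_eq, Set.mem_singleton_iff, Prod.ext_iff,
      Prod.fst_sum, Prod.snd_sum, Nat.cast_sum, Function.comp_apply, Pi.one_apply, mul_ite,
      mul_one, mul_zero]
    split_ifs with h
    · rw [Measure.pi_singleton, Function.comp_def, prod_excursionLaw_singleton, h.1, Nat.cast_sum,
        h.2]
    · rfl
  · intro τ hτ k
    rw [Subtype.range_coe]
    by_contra hk
    refine hτ ?_
    rw [Set.indicator_apply, Measure.pi_singleton,
      Finset.prod_eq_zero (Finset.mem_univ k) (excursionLaw_singleton_of_notMem hk), ite_self]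

lemma jointLaw_eq (p q : ℕ) (l : ℤ) :
    jointLaw p q l = 4 ^ (q - l - p) * (excursionCount p q l).toReal := by
  have hpow (n : ℤ) : ((4 : ℝ≥0∞) ^ n).toReal = 4 ^ n := by
    rw [← ENNReal.coe_ofNat, ← ENNReal.coe_zpow (by simp), ENNReal.coe_toReal, NNReal.coe_zpow]
    rfl
  rw [jointLaw, Measure.real, pi_excursionLaw_apply, ENNReal.toReal_mul, hpow]

end Laws

section Uniform

lemma count_trees (V : ℕ) (L : Set (Multiset (ℤ × ℤ))) :
    Measure.count ({t : BTree | t ≠ .nil ∧ numEdges t = V} ∩ edges 0 ⁻¹' L) = treeCount V L := by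
  set S := {t : BTree | t ≠ .nil ∧ numEdges t = V} ∩ edges 0 ⁻¹' L with hS
  have hnil : (.nil : BTree) ∉ S := fun h => h.1.1 rfl
  rw [← Measure.tsum_indicator_apply_singleton _ _ .of_discrete]
  simp only [Measure.count_singleton]
  rw [tsum_tree', Set.indicator_of_notMem hnil, zero_add, treeCount]
  refine tsum_congr fun t => Set.indicator_eq_indicator (Eq.to_iff ?_) rfl
  simp [hS, mem_withCard, card_edges 0 t.2, t.2, and_comm]

lemma finite_trees (V : ℕ) : {t : BTree | t ≠ .nil ∧ numEdges t = V}.Finite := by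
  refine (BinaryTree.treesOfNumNodesEq (V + 1)).finite_toSet.subset fun t ht => ?_
  rw [Finset.mem_coe, BinaryTree.mem_treesOfNumNodesEq, ← card_labels 0, labels_eq_cons ht.1,
    Multiset.card_cons, Multiset.card_map, card_edges 0 ht.1, ht.2]

lemma treeCount_ne_top (V : ℕ) (L : Set (Multiset (ℤ × ℤ))) : treeCount V L ≠ ⊤ := by
  rw [← count_trees]
  exact (Measure.count_apply_lt_top.2 ((finite_trees V).inter_of_left _)).ne

lemma toReal_treeCount_ne_zero {V : ℕ} {L : Set (Multiset (ℤ × ℤ))}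
    (h : 0 < uniformTree V (edges 0 ⁻¹' L)) : (treeCount V L).toReal ≠ 0 := by
  rw [uniformTree, uniformOn, cond_apply .of_discrete, count_trees] at h
  exact ENNReal.toReal_ne_zero.2 ⟨right_ne_zero_of_mul h.ne', treeCount_ne_top V L⟩

lemma cond_uniformTree_real (V : ℕ) (L B : Set (Multiset (ℤ × ℤ))) :
    (cond (uniformTree V) (edges 0 ⁻¹' L)).real (edges 0 ⁻¹' B) =
      (treeCount V (L ∩ B)).toReal / (treeCount V L).toReal := by
  rw [uniformTree, uniformOn, cond_cond_eq_cond_inter' .of_discrete .of_discrete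
    (Measure.count_apply_lt_top.2 (finite_trees V)).ne, Measure.real, cond_apply .of_discrete,
    Set.inter_assoc, ← Set.preimage_inter, count_trees, count_trees, ENNReal.toReal_mul,
    ENNReal.toReal_inv, inv_mul_eq_div]

lemma treeCount_congr {V : ℕ} {L L' : Set (Multiset (ℤ × ℤ))}
    (h : ∀ a ∈ edgesOn Set.univ, a.card = V → (a ∈ L ↔ a ∈ L')) :
    treeCount V L = treeCount V L' := by
  refine tsum_congr fun t => Set.indicator_eq_indicator ?_ rfl
  exact and_congr_left fun hc => h _ (edges_mem_edgesOn_univ 0 t) (Nat.cast_inj.1 hc)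

end Uniform

section Transition

/-- The event that the edge profiles at the times in `K` are given by `x`. -/
def profileEvent (K : Set ℕ) (x : ℕ → ℕ × ℕ × ℕ) : Set (Multiset (ℤ × ℤ)) :=
  {a | a ∈ edgesOn Set.univ ∧ ∀ k ∈ K, edgeProfile k a = x k}

lemma preimage_profileEvent (K : Set ℕ) (x : ℕ → ℕ × ℕ × ℕ) :
    edges 0 ⁻¹' profileEvent K x = {t | ∀ k ∈ K, profile k t = x k} :=
  Set.ext fun t => and_iff_right (edges_mem_edgesOn_univ 0 t)

variable {K : Set ℕ} {x : ℕ → ℕ × ℕ × ℕ} {m p q v : ℕ}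

lemma isLowEvent_profileEvent (hK : IsGreatest K m) (hx : x m = (p, q, v)) :
    IsLowEvent m p q (v + p + q) (profileEvent K x) where
  subset_edgesOn _ ha := ha.1
  add_mem_iff a b hb := by
    have hab : a + b ∈ edgesOn Set.univ ↔ a ∈ edgesOn Set.univ := by
      simp only [add_mem_edgesOn, edgesOn_le_univ hb, and_true]
    exact and_congr hab <| forall₂_congr fun k hk => by
      rw [edgeProfile_add_high (hK.2 hk) a hb]
  count_up a ha := congrArg Prod.fst ((ha.2 m hK.1).trans hx)
  count_down a ha := congrArg (fun y => y.2.1) ((ha.2 m hK.1).trans hx)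
  card_eq a ha hlow := by rw [card_of_mem_low hlow, ha.2 m hK.1, hx]

lemma treeCount_inter_edgeProfile_succ (hK : IsGreatest K m) (hx : x m = (p, q, v))
    (V r s w : ℕ) :
    treeCount V (profileEvent K x ∩ edgeProfile (m + 1) ⁻¹' {(r, s, w)}) =
      if w = v + p + q then treeCount V (profileEvent K x ∩ crossings m ⁻¹' {(r, s)}) else 0 := by
  have hsucc : ∀ a ∈ profileEvent K x, edgeProfile (m + 1) a = (r, s, w) ↔
      crossings m a = (r, s) ∧ v + p + q = w := fun a ha => by
    rw [edgeProfile_succ m ha.1, ha.2 m hK.1, hx, Prod.ext_iff, Prod.ext_iff, Prod.ext_iff]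
    exact and_assoc.symm
  split_ifs with hw
  · refine treeCount_congr fun a _ _ => and_congr_right fun ha => (hsucc a ha).trans ?_
    exact and_iff_left hw.symm
  · refine ENNReal.tsum_eq_zero.2 fun t => Set.indicator_of_notMem (fun ht => hw ?_) _
    exact ((hsucc _ ht.1.1).1 ht.1.2).2.symm

lemma treeCount_inter_edgeProfile_succ_of_full {V : ℕ} (hK : IsGreatest K m)
    (hx : x m = (0, 0, V)) (y : ℕ × ℕ × ℕ) :
    treeCount V (profileEvent K x ∩ edgeProfile (m + 1) ⁻¹' {y}) =
      if y = (0, 0, V) then treeCount V (profileEvent K x) else 0 := by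
  have hsucc : ∀ a ∈ profileEvent K x, a.card = V → edgeProfile (m + 1) a = (0, 0, V) :=
    fun a ha hc => by
      subst hc
      exact edgeProfile_succ_of_full ha.1 ((ha.2 m hK.1).trans hx)
  split_ifs with hy
  · exact treeCount_congr fun a _ hc => and_iff_left_of_imp fun ha => (hsucc a ha hc).trans hy.symm
  · refine ENNReal.tsum_eq_zero.2 fun t => Set.indicator_of_notMem (fun ht => hy ?_) _
    exact (Eq.symm ht.1.2).trans (hsucc _ ht.1.1 (Nat.cast_inj.1 ht.2))

lemma jointLaw_ratio {V p q v r s w : ℕ} (hw : w = v + p + q) :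
    (4 : ℝ) ^ (-(p : ℤ) - (s : ℤ)) *
        (jointLaw r s ((V : ℤ) - w - r) / jointLaw p q ((V : ℤ) - v - p)) =
      (excursionCount r s (V - w - r)).toReal / (excursionCount p q (V - v - p)).toReal := by
  have hexp : (s - (V - w - r) - r : ℤ) = (q - (V - v - p) - p) + (p + s) := by
    rw [hw]
    push_cast
    ring
  have hneg : (-p - s : ℤ) = -(p + s) := by ring
  rw [jointLaw_eq, jointLaw_eq, hexp, zpow_add₀ (by norm_num), hneg, zpow_neg]
  field_simp

/-- The transition probabilities of the edge profile for trees with `V` edges. The second `if`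
treats the absorbing state, where the formula would read `0 / 0`. -/
def transitionProb (V : ℕ) : ℕ × ℕ × ℕ → ℕ × ℕ × ℕ → ℝ := fun (p, q, v) (r, s, w) =>
  if w = v + p + q then
    if p = 0 ∧ q = 0 ∧ r = 0 ∧ s = 0 then 1
    else (p : ℝ) * (4 : ℝ) ^ (-(p : ℤ) - (s : ℤ)) / ((p : ℝ) + (s : ℝ))
      * ((p + s).choose r : ℝ) * ((p + s).choose q : ℝ)
      * (jointLaw r s ((V : ℤ) - w - r) / jointLaw p q ((V : ℤ) - v - p))
  else 0

lemma transitionProb_of_ne_zero {p : ℕ} (hp : p ≠ 0) (V q v r s w : ℕ) :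
    transitionProb V (p, q, v) (r, s, w) =
      if w = v + p + q then p * (stepWeight p q r s).toReal *
        ((excursionCount r s (V - w - r)).toReal / (excursionCount p q (V - v - p)).toReal)
      else 0 := by
  simp only [transitionProb, hp, false_and, if_false]
  refine if_ctx_congr Iff.rfl (fun hw => ?_) fun _ => rfl
  rw [← jointLaw_ratio hw, stepWeight, ENNReal.toReal_div, ENNReal.toReal_mul]
  simp only [ENNReal.toReal_natCast]
  push_cast
  ring

lemma transitionProb_full {V : ℕ} {y : ℕ × ℕ × ℕ} (hy : y ∈ stateSpace V) :
    transitionProb V (0, 0, V) y = if y = (0, 0, V) then 1 else 0 := by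
  obtain ⟨r, s, w⟩ := y
  rcases hy with hy | hy
  · have hr : r ≠ 0 := hy.1.ne'
    simp [transitionProb, hr]
  · cases hy
    simp [transitionProb]

lemma jointLaw_zero : jointLaw 0 0 0 = 1 := by
  simp [jointLaw]

lemma eq_full_of_mem_stateSpace {V q v : ℕ} (h : (0, q, v) ∈ stateSpace V) : q = 0 ∧ v = V := by
  simpa [stateSpace] using h

lemma jointLaw_pos (hm : 0 < m) (hK : IsGreatest K m) {V : ℕ} (hx : x m = (p, q, v))
    (hstate : (p, q, v) ∈ stateSpace V) (hpos : (treeCount V (profileEvent K x)).toReal ≠ 0) :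
    0 < jointLaw p q (V - v - p) := by
  rcases eq_or_ne p 0 with rfl | hp
  · obtain ⟨rfl, rfl⟩ := eq_full_of_mem_stateSpace hstate
    simp [jointLaw_zero]
  · have h := congrArg ENNReal.toReal
      (mul_treeCount (Nat.cast_pos.2 hm) hp (isLowEvent_profileEvent hK hx) V)
    rw [ENNReal.toReal_mul, ENNReal.toReal_mul, ENNReal.toReal_natCast] at h
    have hE : (excursionCount p q (V - v - p)).toReal ≠ 0 :=
      right_ne_zero_of_mul (h ▸ mul_ne_zero (Nat.cast_ne_zero.2 hp) hpos)
    rw [jointLaw_eq]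
    positivity

lemma IsLowEvent.treeCount_ratio {m : ℤ} {L : Set (Multiset (ℤ × ℤ))} (hm : 0 < m) (hp : p ≠ 0)
    (hL : IsLowEvent m p q (v + p + q) L) {V : ℕ} (hpos : (treeCount V L).toReal ≠ 0) (r s : ℕ) :
    (treeCount V (L ∩ crossings m ⁻¹' {(r, s)})).toReal / (treeCount V L).toReal =
      p * (stepWeight p q r s).toReal *
        ((excursionCount r s (V - (v + p + q : ℕ) - r)).toReal /
          (excursionCount p q (V - v - p)).toReal) := by
  have hp' : (p : ℝ) ≠ 0 := Nat.cast_ne_zero.2 hp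
  have htotal := congrArg ENNReal.toReal (mul_treeCount hm hp hL V)
  rw [ENNReal.toReal_mul, ENNReal.toReal_mul, ENNReal.toReal_natCast] at htotal
  have hne : (lowerWeight m q L).toReal * (excursionCount p q (V - v - p)).toReal ≠ 0 :=
    htotal ▸ mul_ne_zero hp' hpos
  have hlower := left_ne_zero_of_mul hne
  have hexc := right_ne_zero_of_mul hne
  rw [← mul_div_mul_left _ _ hp', htotal, treeCount_inter_crossings hm hp hL, ENNReal.toReal_mul,
    ENNReal.toReal_mul]
  field_simp

lemma cond_uniformTree_eq_transitionProb (hm : 0 < m) (hK : IsGreatest K m) {V : ℕ}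
    (hx : x m = (p, q, v)) (hstate : (p, q, v) ∈ stateSpace V) {y : ℕ × ℕ × ℕ}
    (hy : y ∈ stateSpace V) (hpos : 0 < uniformTree V {t | ∀ k ∈ K, profile k t = x k}) :
    0 < jointLaw p q (V - v - p) ∧
      (cond (uniformTree V) {t | ∀ k ∈ K, profile k t = x k}).real {t | profile (m + 1) t = y} =
        transitionProb V (p, q, v) y := by
  rw [← preimage_profileEvent] at hpos ⊢
  have hcount := toReal_treeCount_ne_zero hpos
  refine ⟨jointLaw_pos hm hK hx hstate hcount,
    (cond_uniformTree_real V _ (edgeProfile (m + 1) ⁻¹' {y})).trans ?_⟩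
  rcases eq_or_ne p 0 with rfl | hp
  · obtain ⟨rfl, rfl⟩ := eq_full_of_mem_stateSpace hstate
    rw [transitionProb_full hy, treeCount_inter_edgeProfile_succ_of_full hK hx]
    split_ifs
    · exact div_self hcount
    · simp
  · obtain ⟨r, s, w⟩ := y
    rw [transitionProb_of_ne_zero hp, treeCount_inter_edgeProfile_succ hK hx]
    split_ifs with hw
    · rw [hw, (isLowEvent_profileEvent hK hx).treeCount_ratio (Nat.cast_pos.2 hm) hp hcount]
    · simp

end Transition

end EdgeProfile

end

theorem theorem5p3 (V : ℕ) (hV : 1 ≤ V) (p q v r s w : ℕ)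
    (hx : (p, q, v) ∈ EdgeProfile.stateSpace V) (hy : (r, s, w) ∈ EdgeProfile.stateSpace V)
    (m : ℕ) (hm : 1 ≤ m)
    (hpos : 0 < EdgeProfile.uniformTree V {t | EdgeProfile.profile m t = (p, q, v)}) :
    -- the denominator in the formula does not vanish
    0 < EdgeProfile.jointLaw p q ((V : ℤ) - v - p) ∧
    -- the one-step transition probability
    (ProbabilityTheory.cond (EdgeProfile.uniformTree V)
        {t | EdgeProfile.profile m t = (p, q, v)}).real
          {t | EdgeProfile.profile (m + 1) t = (r, s, w)} =
      (if w = v + p + q then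
        if p = 0 ∧ q = 0 ∧ r = 0 ∧ s = 0 then 1
        else (p : ℝ) * (4 : ℝ) ^ (-(p : ℤ) - (s : ℤ)) / ((p : ℝ) + (s : ℝ))
          * ((p + s).choose r : ℝ) * ((p + s).choose q : ℝ)
          * (EdgeProfile.jointLaw r s ((V : ℤ) - w - r) /
              EdgeProfile.jointLaw p q ((V : ℤ) - v - p))
      else 0) ∧
    -- it is also the transition probability given the whole past (Markov property)
    ∀ past : ℕ → ℕ × ℕ × ℕ, past m = (p, q, v) →
      0 < EdgeProfile.uniformTree V
        {t | ∀ k ∈ Finset.Icc 1 m, EdgeProfile.profile k t = past k} →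
      (ProbabilityTheory.cond (EdgeProfile.uniformTree V)
          {t | ∀ k ∈ Finset.Icc 1 m, EdgeProfile.profile k t = past k}).real
            {t | EdgeProfile.profile (m + 1) t = (r, s, w)} =
        (ProbabilityTheory.cond (EdgeProfile.uniformTree V)
          {t | EdgeProfile.profile m t = (p, q, v)}).real
            {t | EdgeProfile.profile (m + 1) t = (r, s, w)} := by
  have hlaw {K : Set ℕ} {x : ℕ → ℕ × ℕ × ℕ} (hK : IsGreatest K m) (hxm : x m = (p, q, v)) :=
    EdgeProfile.cond_uniformTree_eq_transitionProb hm hK hxm hx hy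
  have hpresent := hlaw (x := fun _ => (p, q, v)) (isGreatest_singleton (a := m)) rfl
  simp only [Set.mem_singleton_iff, forall_eq] at hpresent
  obtain ⟨hden, htrans⟩ := hpresent hpos
  refine ⟨hden, htrans, fun past hpast hpos' => ?_⟩
  have hgreatest : IsGreatest (Finset.Icc 1 m : Set ℕ) m :=
    ⟨Finset.mem_Icc.2 ⟨hm, le_rfl⟩, fun _ hk => (Finset.mem_Icc.1 hk).2⟩
  exact (hlaw hgreatest hpast hpos').2.trans htrans.symm
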